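/- Setting. A digraph $\mathcal G=(\mathcal V,\mathcal E)$ has $n>1$ nodes; $\mathcal N_i=\{j:(j,i)\in\mathcal E\}$. For $S\subset\mathcal V$ let $\mathcal X^r_S$ be the set of nodes of $S$ with at least $r$ neighbors outside $S$. $\mathcal G$ is $(r,s)$-robust ($r,s<n$) if for all nonempty disjoint $S_1,S_2\subset\mathcal V$ we have $\mathcal X^r_{S_1}=S_1$, or $\mathcal X^r_{S_2}=S_2$, or $|\mathcal X^r_{S_1}|+|\mathcal X^r_{S_2}|\ge s$; it is $r$-robust if it is $(r,1)$-robust. Let $T>0$ be a sampling period, $r$ a desired velocity, $\delta_{ij}$ desired relative positions with $\delta_{ij}+\delta_{jl}=\delta_{il}$, $\alpha_i>0$ gains, $a_{ij}[k]$ edge weights with $a_{ij}[k]\ge\gamma>0$ for $(j,i)\in\mathcal E$, $k\geq 0$, and $f,\tau\in\mathbb Z_{\ge0}$. Every vehicle $i\in\mathcal V$ obeys $$x_i[k+1]=x_i[k]+Tv_i[k]+\tfrac{T^2}{2}u_i[k],\qquad v_i[k+1]=v_i[k]+Tu_i[k]\qquad(k\ge 0),$$ with arbitrary positions at times $k<0$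 as initial history. Put $p_i[k]=x_i[k]-kTr$, $q_i[k]=v_i[k]-r$. A set $\mathcal M$ of at most $f$ vehicles is malicious ($f$-total malicious model): they choose $u_i$ arbitrarily, and may send arbitrary positions to the vehicles that rely on communication; vehicles in a given (possibly empty) set measure true positions instead. Each normal vehicle $i\notin\mathcal M$ applies $$u_i[k]=\sum_{j\in\mathcal N_i\setminus I_i[k]}a_{ij}[k]\bigl(p_j[k-\tau_{ij}[k]]-p_i[k]-\delta_{ij}\bigr)-\alpha_iq_i[k],\qquad 0\le\tau_{ij}[k]\le\tau,$$ where $p_j$ is the position of $j$ as known to $i$, and $I_i[k]$ is the set of ignored neighbors given by the ADP-MSR algorithm. If $i$ makes an update at time $k$, then $I_i[k]$ consists of all neighbors with $p_j[k-\tau_{ij}[k]]-p_i[k]-\delta_{ij}\ge0$ if these are fewer than $f$, and otherwise of $f$ neighbors with the largest such values, together with, symmetrically, all neighbors with values $\le0$ if these are fewer than $f$, and otherwise $f$ neighbors with the smallest values. If $i$ does not make an update at time $k$, it keeps the position values of its neighbors and the ignored set of time $k-1$ (so that $\tau_{ij}[k]=\tau_{ij}[k-1]+1$). Update times and delays are otherwise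 arbitrary. The network achieves resilient coordinated movement if for every $\mathcal M$ with $|\mathcal M|\le f$ and every run as above, $x_j[k]-x_i[k]\to\delta_{ij}$ and $v_i[k]\to r$ as $k\to\infty$ for all $i,j\notin\mathcal M$. Theorem. (a) Suppose that for each $i$ there is $S_i$ with $\sum_{j\in\mathcal N_i}a_{ij}[k]\le S_i$ for all $k\ge0$ and $$2\sqrt{S_i}\;\le\;\alpha_i+\tfrac{T S_i}{2}\;<\;\tfrac2T.$$ If $\mathcal G$ is $(2f+1)$-robust, then the network achieves resilient coordinated movement, and at an exponential rate: there is $\rho\in(0,1)$ such that for every $\mathcal M$ and every run there is $C$ with $|x_j[k]-x_i[k]-\delta_{ij}|\le C\rho^k$ and $|v_i[k]-r|\le C\rho^k$ for all $i,j\notin\mathcal M$, $k\ge0$. (b) Conversely (without the condition on the gains), if the network achieves resilient coordinated movement, then $\mathcal G$ is $(f+1,f+1)$-robust. -/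

import Mathlib

open Filter Topology

noncomputable section

open Classical in
/-- The neighbours of `i`: the nodes `j` with an edge from `j` to `i`. -/
def inNeighbors {V : Type*} [Fintype V] (G : Digraph V) (i : V) : Finset V :=
  Finset.univ.filter (fun j => G.Adj j i)

open Classical in
/-- The nodes of `S` that have at least `r` incoming edges from outside of `S`. -/
def reachable {V : Type*} [Fintype V] (G : Digraph V) (r : ℕ) (S : Finset V) : Finset V :=
  S.filter (fun i => r ≤ (inNeighbors G i \ S).card)

/-- `(r, s)`-robustness of a digraph on `n = Fintype.card V` nodes. -/
def IsRobust {V : Type*} [Fintype V] (G : Digraph V) (r s : ℕ) : Prop :=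
  r < Fintype.card V ∧ s < Fintype.card V ∧
    ∀ V₁ V₂ : Finset V, V₁.Nonempty → V₂.Nonempty → Disjoint V₁ V₂ →
      reachable G r V₁ = V₁ ∨ reachable G r V₂ = V₂ ∨
        s ≤ (reachable G r V₁).card + (reachable G r V₂).card

/-- The data of a network of vehicles. -/
structure VehicleNetwork (V : Type*) where
  /-- the communication graph -/
  G : Digraph V
  /-- the sampling period -/
  T : ℝ
  /-- the desired velocity -/
  r : ℝ
  /-- `δ i j` is the desired position of `j` relative to `i` -/
  δ : V → V → ℝ
  /-- the velocity feedback gains -/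
  α : V → ℝ
  /-- `a k i j` is the weight at time `k` of the edge `(j, i)`, before any edge is ignored -/
  a : ℕ → V → V → ℝ
  /-- the bound for the communication delays -/
  τ : ℕ
  /-- the bound for the number of malicious vehicles, used in the filtering -/
  f : ℕ
  /-- the vehicles with an active sensing system, which measure true positions; all others
  trust what their neighbours broadcast -/
  active : Set V

/-- A run of the network. Time is `ℤ`, the initial time is `0`, and the values at negative times
are the initial history of the network. -/
structure NetworkRun (V : Type*) where
  /-- positions -/
  x : V → ℤ → ℝ
  /-- velocities -/
  v : V → ℤ → ℝ
  /-- control inputs -/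
  u : V → ℤ → ℝ
  /-- `seen i j k` is the position of `j` at time `k` as it is measured by, or sent to, `i` -/
  seen : V → V → ℤ → ℝ
  /-- the times at which a vehicle makes an update -/
  upd : V → Set ℤ
  /-- `delay i j k` is the age of the position value of `j` that `i` uses at time `k` -/
  delay : V → V → ℤ → ℕ
  /-- the neighbours of `i` whose edges `i` ignores at time `k` -/
  ignored : V → ℤ → Finset V

namespace NetworkRun

variable {V : Type*} (N : VehicleNetwork V) (e : NetworkRun V)

/-- The transformed position `p i k`, where `x i k = p i k + k T r`. -/
def p (i : V) (k : ℤ) : ℝ := e.x i k - k * N.T * N.r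

/-- The transformed velocity `q i k`, where `v i k = q i k + r`. -/
def q (i : V) (k : ℤ) : ℝ := e.v i k - N.r

/-- The transformed position of `j` at time `k` as seen by `i`. -/
def pSeen (i j : V) (k : ℤ) : ℝ := e.seen i j k - k * N.T * N.r

/-- The relative position value `p_j[k - τ_ij[k]] - p_i[k] - δ_ij` that `i` calculates. -/
def rel (i j : V) (k : ℤ) : ℝ :=
  e.pSeen N i j (k - (e.delay i j k : ℤ)) - e.p N i k - N.δ i j

end NetworkRun

open Classical in
/-- `H` is a set of neighbours (elements of `B`) ignored on the side of the large values of `d`: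
all those with `0 ≤ d j` if these are less than `f`, and else `f` ones with the largest values,
where ties are broken arbitrarily. -/
def IgnoresLargest {V : Type*} (f : ℕ) (B : Finset V) (d : V → ℝ) (H : Finset V) : Prop :=
  H ⊆ B ∧
    if (B.filter (fun j => 0 ≤ d j)).card < f then H = B.filter (fun j => 0 ≤ d j)
    else H.card = f ∧ ∀ j ∈ H, ∀ l ∈ B \ H, d l ≤ d j

open Classical in
/-- The filtering step: `S` consists of the neighbours ignored for their large values and of
those ignored for their small values (large values of `-d`). -/
def IgnoresExtremes {V : Type*} (f : ℕ) (B : Finset V) (d : V → ℝ) (S : Finset V) : Prop :=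
  ∃ H L : Finset V, IgnoresLargest f B d H ∧ IgnoresLargest f B (fun j => - d j) L ∧ S = H ∪ L

open Classical in
/-- `e` is a possible run of the network `N` when `M` is the set of malicious vehicles.
All vehicles obey the sampled double-integrator dynamics. Malicious vehicles choose their inputs
arbitrarily and send arbitrary positions to the vehicles that rely on communication. Normal vehicles
execute the filtering algorithm and apply the resulting control input. -/
structure IsRun {V : Type*} [Fintype V] (N : VehicleNetwork V) (M : Finset V)
    (e : NetworkRun V) : Prop where
  position : ∀ (i : V) (k : ℕ),
    e.x i (k + 1) = e.x i k + N.T * e.v i k + N.T ^ 2 / 2 * e.u i k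
  velocity : ∀ (i : V) (k : ℕ), e.v i (k + 1) = e.v i k + N.T * e.u i k
  truthful : ∀ (i j : V) (k : ℤ), j ∉ M ∨ i ∈ N.active → e.seen i j k = e.x j k
  delay_le : ∀ i ∉ M, ∀ j ∈ inNeighbors N.G i, ∀ k : ℤ, e.delay i j k ≤ N.τ
  /-- at an update the extreme values are filtered out -/
  update : ∀ i ∉ M, ∀ k ∈ e.upd i,
    IgnoresExtremes N.f (inNeighbors N.G i) (fun j => e.rel N i j k) (e.ignored i k)
  /-- otherwise the position values of the neighbours, which are one step older now, and the
  ignored edges remain as they were -/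
  hold : ∀ i ∉ M, ∀ k ∉ e.upd i, e.ignored i k = e.ignored i (k - 1) ∧
    ∀ j ∈ inNeighbors N.G i, e.delay i j k = e.delay i j (k - 1) + 1
  control : ∀ i ∉ M, ∀ k : ℕ,
    e.u i k = (∑ j ∈ inNeighbors N.G i \ e.ignored i k, N.a k i j * e.rel N i j k)
      - N.α i * e.q N i k

/-- Resilient coordinated movement under the `f`-total malicious model: for every set of at most
`f` malicious vehicles and every run. -/
def ResilientMovement {V : Type*} [Fintype V] (N : VehicleNetwork V) : Prop :=
  ∀ M : Finset V, M.card ≤ N.f → ∀ e : NetworkRun V, IsRun N M e →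
    (∀ i ∉ M, ∀ j ∉ M,
      Tendsto (fun k : ℕ => e.x j k - e.x i k) atTop (𝓝 (N.δ i j))) ∧
    ∀ i ∉ M, Tendsto (fun k : ℕ => e.v i k) atTop (𝓝 N.r)

/-- The convergence in resilient coordinated movement is exponential, with a rate `ρ` that is
common to all sets of malicious vehicles and all runs. -/
def ExponentialRate {V : Type*} [Fintype V] (N : VehicleNetwork V) : Prop :=
  ∃ ρ : ℝ, 0 < ρ ∧ ρ < 1 ∧
    ∀ M : Finset V, M.card ≤ N.f → ∀ e : NetworkRun V, IsRun N M e →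
      ∃ C : ℝ, ∀ k : ℕ,
        (∀ i ∉ M, ∀ j ∉ M, |e.x j k - e.x i k - N.δ i j| ≤ C * ρ ^ k) ∧
        ∀ i ∉ M, |e.v i k - N.r| ≤ C * ρ ^ k

/-- The standing assumptions on the data: positive sampling period and gains, relative positions
that fit together, and edge weights bounded away from zero. -/
def WellPosed {V : Type*} (N : VehicleNetwork V) : Prop :=
  0 < N.T ∧ (∀ i, 0 < N.α i) ∧ (∀ i j l, N.δ i j + N.δ j l = N.δ i l) ∧
    ∃ γ : ℝ, 0 < γ ∧ ∀ (k : ℕ) (i j : V), N.G.Adj j i → γ ≤ N.a k i j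

/-- The velocity gains fit the weights and the sampling period: with a bound `S i` for the total
weight at `i`, the recursion of the single vehicle `i` towards a fixed position is stable and
does not oscillate. -/
def GainCondition {V : Type*} [Fintype V] (N : VehicleNetwork V) : Prop :=
  ∀ i, ∃ S : ℝ, (∀ k : ℕ, ∑ j ∈ inNeighbors N.G i, N.a k i j ≤ S) ∧
    2 * √S ≤ N.α i + N.T * S / 2 ∧ N.α i + N.T * S / 2 < 2 / N.T

end

/-! For each vehicle, a suitable c > 0 replaces the state (p, q) by p and y = p + c q. The gain
condition provides a c for which the new p and the new y are weighted averages, with nonnegative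
weights, of the old p, the old y and the used neighbour values (`exists_timeConstant`,
`exists_stepBound`). Once the desired offsets are subtracted, filtering keeps every retained value
within the range of the recent normal positions (`used_le`). Hence an interval [m, b] that contains
the recent positions and the y of all normal vehicles stays valid forever (`below_add`), and the
distance of y to an end shrinks by at most a factor η per step.

Robustness makes the interval contract. Split the vehicles by whether y lies above the midpoint.
Some member of one group has 2f + 1 neighbours outside its group, and after the delay has passed,
some value that it retains is away from the end in question. This pulls the member away from that
end and out of the group. After boundedly many rounds one group is empty (`exists_side`), so one end
moves inward by a fixed fraction of the width (`contraction`). The width bounds position differences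
as well as c |q| = |y - p|, which gives the exponential rate.

For the converse, two groups that violate robustness start in formations shifted against each other
by 1. The members with more than f neighbours outside their group are malicious and do not
accelerate. Every other member sees at most f values that are not zero and filters them out, so the
shift persists (`stateAt_eq`, `false_of_groups`). -/

/-! ### Gains and the one-step estimate for a single vehicle -/

/-- The normalized form (`T = 1`) of the choice of the auxiliary time constant. -/
theorem exists_timeConstant_aux {β S : ℝ} (hβ0 : 0 < β) (hβ : β < 2) (hS : 0 ≤ S)
    (h4 : 4 * S ≤ β ^ 2) :
    ∃ d : ℝ, 1 / 2 < d ∧ 3 - β ≤ d * (2 - S) ∧ d * (2 * β - 2 - S) < 1 ∧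
      S * d ^ 2 + 1 ≤ β * d := by
  have hS1 : S < 1 := by nlinarith
  -- At d = 2 / β the last inequality is exactly 4S ≤ β², but d (2β - 2 - S) < 1 can fail there when
  -- S ≤ β - 1. In that range d is taken as small as 3 - β ≤ d (2 - S) permits.
  rcases le_or_gt S (β - 1) with h | h
  · have h2 : 0 < 2 - S := by linarith
    refine ⟨(3 - β) / (2 - S), ?_, ?_, ?_, ?_⟩
    · rw [div_lt_div_iff₀ (by norm_num) h2]; nlinarith
    · rw [div_mul_cancel₀ _ h2.ne']
    · rw [div_mul_eq_mul_div, div_lt_one h2]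
      nlinarith [mul_pos (sub_pos.2 hβ) (sub_pos.2 hβ), mul_nonneg hS (sub_pos.2 hβ).le]
    · have key : (2 - S - (3 - β)) * (2 - S - 2 * (3 - β)) ≤ 0 :=
        mul_nonpos_of_nonneg_of_nonpos (by linarith) (by linarith)
      have e : β * ((3 - β) / (2 - S)) - (S * ((3 - β) / (2 - S)) ^ 2 + 1)
          = -((2 - S - (3 - β)) * (2 - S - 2 * (3 - β))) / (2 - S) ^ 2 := by
        field_simp; ring
      have : 0 ≤ -((2 - S - (3 - β)) * (2 - S - 2 * (3 - β))) / (2 - S) ^ 2 :=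
        div_nonneg (by linarith) (by positivity)
      linarith
  · refine ⟨2 / β, ?_, ?_, ?_, ?_⟩
    · rw [div_lt_div_iff₀ (by norm_num) hβ0]; linarith
    · rw [div_mul_eq_mul_div, le_div_iff₀ hβ0]
      nlinarith [mul_pos (sub_pos.2 hβ) (by linarith : 0 < 4 - β)]
    · rw [div_mul_eq_mul_div, div_lt_one hβ0]; linarith
    · rw [mul_div_cancel₀ _ hβ0.ne', div_pow, mul_div_assoc', ← le_sub_iff_add_le,
        div_le_iff₀ (by positivity)]
      linarith

/-- Under the gain condition there is `c > 0` for which the recursion in the coordinates `p` and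
`p + c * q` has nonnegative coefficients. -/
theorem exists_timeConstant {T α S : ℝ} (hT : 0 < T) (hα : 0 < α) (hS : 0 ≤ S)
    (h1 : 2 * √S ≤ α + T * S / 2) (h2 : α + T * S / 2 < 2 / T) :
    ∃ c : ℝ, 0 < c ∧ 0 < T - T ^ 2 / 2 * α ∧
      c * (T ^ 2 / 2 * S) + (T - T ^ 2 / 2 * α) ≤ c ∧
      0 < T + c - T * (c + T / 2) * α ∧
      c * (c + T / 2) * S + 1 ≤ (c + T / 2) * α := by
  have hβ : T * (α + T * S / 2) < 2 := by
    rw [lt_div_iff₀ hT] at h2; linarith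
  have hTS : 0 ≤ T * S := by positivity
  have h4 : 4 * S ≤ (α + T * S / 2) ^ 2 := by
    have := pow_le_pow_left₀ (by positivity) h1 2
    rw [mul_pow, Real.sq_sqrt hS] at this
    linarith
  -- Here d is (c + T/2) / T, and the gains are made dimensionless.
  obtain ⟨d, hd, e1, e2, e3⟩ := exists_timeConstant_aux (β := T * (α + T * S / 2))
    (S := T ^ 2 * S) (by positivity) hβ (by positivity) (by nlinarith [sq_nonneg T])
  refine ⟨T * (d - 1 / 2), mul_pos hT (by linarith), ?_, ?_, ?_, ?_⟩
  · nlinarith [mul_nonneg hT.le hTS]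
  · nlinarith
  · nlinarith
  · nlinarith

/-- One step of a single vehicle that is attracted by the positions `z j`: the new values of `p` and
`p + c * q` stay below an upper bound `b` of the old ones and of the `z j`, and their distance
to `b` is at least a fixed fraction of the distance to `b` of the old values. -/
def StepBound (V : Type*) (T α S γ c η : ℝ) : Prop :=
  ∀ (R : Finset V) (a z : V → ℝ) (p q u b : ℝ), (∀ j ∈ R, γ ≤ a j) → ∑ j ∈ R, a j ≤ S →
    p ≤ b → p + c * q ≤ b → (∀ j ∈ R, z j ≤ b) → u = ∑ j ∈ R, a j * (z j - p) - α * q →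
    p + T * q + T ^ 2 / 2 * u ≤ b - η * (b - (p + c * q)) ∧
    p + T * q + T ^ 2 / 2 * u + c * (q + T * u) ≤ b - η * (b - (p + c * q)) ∧
    ∀ j ∈ R, p + T * q + T ^ 2 / 2 * u + c * (q + T * u) ≤ b - η * (b - z j)

theorem StepBound.mono {V : Type*} {T α S γ c η η' : ℝ} (h : StepBound V T α S γ c η)
    (hη : η' ≤ η) : StepBound V T α S γ c η' := by
  intro R a z p q u b ha hS hp hy hz hu
  obtain ⟨h1, h2, h3⟩ := h R a z p q u b ha hS hp hy hz hu
  have := mul_le_mul_of_nonneg_right hη (sub_nonneg.2 hy)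
  refine ⟨by linarith, by linarith, fun j hj => ?_⟩
  have := mul_le_mul_of_nonneg_right hη (sub_nonneg.2 (hz j hj))
  linarith [h3 j hj]

/-- The constant η is the least of three weights: that of y in the new p, that of y in the new y,
and the lower bound for that of a single retained neighbour in the new y. A neighbour need not
influence the new p by this amount, so only y is claimed to react to it. -/
theorem exists_stepBound (V : Type*) {T α S γ : ℝ} (hT : 0 < T) (hα : 0 < α) (hS : 0 ≤ S)
    (hγ : 0 < γ) (h1 : 2 * √S ≤ α + T * S / 2) (h2 : α + T * S / 2 < 2 / T) :
    ∃ c η : ℝ, 0 < c ∧ 0 < η ∧ StepBound V T α S γ c η := by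
  obtain ⟨c, hc, e1, e2, e3, e4⟩ := exists_timeConstant hT hα hS h1 h2
  refine ⟨c, min ((T - T ^ 2 / 2 * α) / c) (min ((T + c - T * (c + T / 2) * α) / c)
    (T * (c + T / 2) * γ)), hc, by positivity, ?_⟩
  set η := min ((T - T ^ 2 / 2 * α) / c) (min ((T + c - T * (c + T / 2) * α) / c)
    (T * (c + T / 2) * γ)) with hη
  have k1 : η * c ≤ T - T ^ 2 / 2 * α := (le_div_iff₀ hc).1 (min_le_left _ _)
  have k2 : η * c ≤ T + c - T * (c + T / 2) * α :=
    (le_div_iff₀ hc).1 ((min_le_right _ _).trans (min_le_left _ _))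
  have k3 : η ≤ T * (c + T / 2) * γ := (min_le_right _ _).trans (min_le_right _ _)
  intro R a z p q u b ha hW hp hy hz hu
  set W := ∑ j ∈ R, a j with hWdef
  set D := ∑ j ∈ R, a j * (b - z j) with hD
  have hnn : ∀ j ∈ R, 0 ≤ a j * (b - z j) := fun j hj =>
    mul_nonneg (hγ.le.trans (ha j hj)) (sub_nonneg.2 (hz j hj))
  have hD0 : 0 ≤ D := Finset.sum_nonneg hnn
  have hu' : u = W * (b - p) - D - α * q := by
    rw [hu, hWdef, hD, Finset.sum_mul, ← Finset.sum_sub_distrib]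
    congr 1
    exact Finset.sum_congr rfl fun j _ => by ring
  have hbp : 0 ≤ b - p := sub_nonneg.2 hp
  have hby : 0 ≤ b - (p + c * q) := sub_nonneg.2 hy
  -- Writing q = (y - p) / c and clearing c expresses the new distances to b by the old ones. The
  -- inequalities for c are the signs of these coefficients, at the worst case W = S.
  have i1 : c * (b - (p + T * q + T ^ 2 / 2 * u)) =
      (c - c * (T ^ 2 / 2 * W) - (T - T ^ 2 / 2 * α)) * (b - p) + c * (T ^ 2 / 2) * D
        + (T - T ^ 2 / 2 * α) * (b - (p + c * q)) := by rw [hu']; ring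
  have i2 : c * (b - (p + T * q + T ^ 2 / 2 * u + c * (q + T * u))) =
      T * ((c + T / 2) * α - 1 - c * (c + T / 2) * W) * (b - p) + c * (T * (c + T / 2)) * D
        + (T + c - T * (c + T / 2) * α) * (b - (p + c * q)) := by rw [hu']; ring
  have c1 : 0 ≤ (c - c * (T ^ 2 / 2 * W) - (T - T ^ 2 / 2 * α)) * (b - p) := by
    refine mul_nonneg ?_ hbp
    have : c * (T ^ 2 / 2 * W) ≤ c * (T ^ 2 / 2 * S) := by gcongr
    linarith
  have c2 : 0 ≤ T * ((c + T / 2) * α - 1 - c * (c + T / 2) * W) * (b - p) := by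
    refine mul_nonneg (mul_nonneg hT.le ?_) hbp
    have : c * (c + T / 2) * W ≤ c * (c + T / 2) * S := by gcongr
    linarith
  have c3 : 0 ≤ c * (T ^ 2 / 2) * D := by positivity
  have c4 : 0 ≤ c * (T * (c + T / 2)) * D := by positivity
  have m1 := mul_le_mul_of_nonneg_right k1 hby
  have m2 := mul_le_mul_of_nonneg_right k2 hby
  have m3 : 0 ≤ (T + c - T * (c + T / 2) * α) * (b - (p + c * q)) := mul_nonneg e3.le hby
  refine ⟨?_, ?_, fun j hj => ?_⟩
  · refine le_of_mul_le_mul_left ?_ hc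
    linarith
  · refine le_of_mul_le_mul_left ?_ hc
    linarith
  · refine le_of_mul_le_mul_left ?_ hc
    have hz0 : 0 ≤ b - z j := sub_nonneg.2 (hz j hj)
    have s1 : a j * (b - z j) ≤ D := Finset.single_le_sum hnn hj
    have s2 : γ * (b - z j) ≤ D := (mul_le_mul_of_nonneg_right (ha j hj) hz0).trans s1
    have s3 : c * (T * (c + T / 2)) * (γ * (b - z j)) ≤ c * (T * (c + T / 2)) * D := by gcongr
    have s4 : c * (η * (b - z j)) ≤ c * ((T * (c + T / 2) * γ) * (b - z j)) := by gcongr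
    linarith

/-! ### The filtering step -/

theorem IgnoresExtremes.neg {V : Type*} {f : ℕ} {B S : Finset V} {d : V → ℝ}
    (h : IgnoresExtremes f B d S) : IgnoresExtremes f B (fun j => - d j) S := by
  obtain ⟨H, L, hH, hL, rfl⟩ := h
  exact ⟨L, H, hL, by simpa using hH, by ext; simp [or_comm]⟩

theorem IgnoresLargest.card_le {V : Type*} {f : ℕ} {B H : Finset V} {d : V → ℝ}
    (h : IgnoresLargest f B d H) : H.card ≤ f := by
  obtain ⟨-, h⟩ := h
  split_ifs at h with h'
  · exact h ▸ h'.le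
  · exact h.1.le

/-- A retained value is negative or at most as large as each of the ignored large values. -/
theorem IgnoresLargest.le_of_mem {V : Type*} {f : ℕ} {B H : Finset V} {d : V → ℝ}
    (h : IgnoresLargest f B d H) {j l : V} (hj : j ∈ B) (hjH : j ∉ H) (hl : l ∈ H) :
    d j ≤ d l := by
  classical
  obtain ⟨-, h⟩ := h
  split_ifs at h with h'
  · subst h
    simp only [Finset.mem_filter, not_and, not_le] at hjH hl
    exact (hjH hj).le.trans hl.2
  · exact h.2 l hl j (by simp [hj, hjH])

/-- If at most `f` values are larger than `b ≥ 0`, then none of these is retained. -/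
theorem IgnoresLargest.le_bound {V : Type*} {f : ℕ} {B H M : Finset V} {d : V → ℝ}
    (h : IgnoresLargest f B d H) (hM : M.card ≤ f) {b : ℝ} (hb : 0 ≤ b)
    (hB : ∀ j ∈ B, j ∉ M → d j ≤ b) {j : V} (hj : j ∈ B) (hjH : j ∉ H) : d j ≤ b := by
  classical
  by_contra! hlt
  -- A retained value above b forces all of H above b as well, so j and H lie in M and H has fewer
  -- than f elements. Then H contains every nonnegative value, yet j is not in it.
  have hsub : insert j H ⊆ M := by
    intro l hl
    by_contra hlM
    rcases Finset.mem_insert.1 hl with rfl | hl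
    · exact (hB _ hj hlM).not_gt hlt
    · exact (hB l (h.1 hl) hlM).not_gt (hlt.trans_le (h.le_of_mem hj hjH hl))
  have hcard := Finset.card_le_card hsub
  rw [Finset.card_insert_of_notMem hjH] at hcard
  obtain ⟨-, h⟩ := h
  split_ifs at h with h'
  · subst h
    simp only [Finset.mem_filter, not_and, not_le] at hjH
    linarith [hjH hj]
  · omega

theorem IgnoresExtremes.le_bound {V : Type*} [DecidableEq V] {f : ℕ} {B S M : Finset V} {d : V → ℝ}
    (h : IgnoresExtremes f B d S) (hM : M.card ≤ f) {b : ℝ} (hb : 0 ≤ b)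
    (hB : ∀ j ∈ B, j ∉ M → d j ≤ b) {j : V} (hj : j ∈ B \ S) : d j ≤ b := by
  obtain ⟨H, L, hH, -, rfl⟩ := h
  simp only [Finset.mem_sdiff, Finset.mem_union, not_or] at hj
  exact hH.le_bound hM hb hB hj.1 hj.2.1

/-- If more than `2 f` neighbours are given and all but `f` of them have values at most `b`, then
a neighbour with value at most `b` is retained. -/
theorem IgnoresExtremes.exists_le {V : Type*} [DecidableEq V] {f : ℕ} {B S M A : Finset V}
    {d : V → ℝ} (h : IgnoresExtremes f B d S) (hM : M.card ≤ f) (hA : A ⊆ B)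
    (hAc : 2 * f + 1 ≤ A.card) {b : ℝ} (hb : ∀ j ∈ A, j ∉ M → d j ≤ b) :
    ∃ j ∈ B \ S, d j ≤ b := by
  obtain ⟨H, L, hH, hL, rfl⟩ := h
  have hHc := hH.card_le
  have hLc := hL.card_le
  -- Both removals cost at most 2f elements: one leaves a retained j, the other some l outside M and
  -- L. Either l itself is retained, or l is in H and dominates j.
  have h1 : (A \ (H ∪ L)).Nonempty := by
    have := Finset.le_card_sdiff (H ∪ L) A
    have := Finset.card_union_le H L
    exact Finset.card_pos.1 (by omega)
  have h2 : ((A \ M) \ L).Nonempty := by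
    have := Finset.le_card_sdiff L (A \ M)
    have := Finset.le_card_sdiff M A
    exact Finset.card_pos.1 (by omega)
  obtain ⟨j, hj⟩ := h1
  obtain ⟨l, hl⟩ := h2
  simp only [Finset.mem_sdiff, Finset.mem_union, not_or] at hj hl
  by_cases hlH : l ∈ H
  · exact ⟨j, by simp [hA hj.1, hj.2],
      (hH.le_of_mem (hA hj.1) hj.2.1 hlH).trans (hb l hl.1.1 hl.1.2)⟩
  · exact ⟨l, by simp [hA hl.1.1, hlH, hl.2], hb l hl.1.1 hl.1.2⟩

theorem IgnoresLargest.congr {V : Type*} {f : ℕ} {B H : Finset V} {d d' : V → ℝ}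
    (h : IgnoresLargest f B d H) (hd : ∀ j ∈ B, d j = d' j) : IgnoresLargest f B d' H := by
  classical
  obtain ⟨hHB, h⟩ := h
  refine ⟨hHB, ?_⟩
  have e : B.filter (fun j => 0 ≤ d j) = B.filter (fun j => 0 ≤ d' j) :=
    Finset.filter_congr fun j hj => by rw [hd j hj]
  rw [e] at h
  split_ifs at h ⊢ with h1
  · exact h
  · refine ⟨h.1, fun j hj l hl => ?_⟩
    rw [← hd j (hHB hj), ← hd l (Finset.mem_sdiff.1 hl).1]
    exact h.2 j hj l hl

theorem IgnoresExtremes.congr {V : Type*} {f : ℕ} {B S : Finset V} {d d' : V → ℝ}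
    (h : IgnoresExtremes f B d S) (hd : ∀ j ∈ B, d j = d' j) : IgnoresExtremes f B d' S := by
  obtain ⟨H, L, hH, hL, hS⟩ := h
  exact ⟨H, L, hH.congr hd, hL.congr fun j hj => by rw [hd j hj], hS⟩

theorem exists_ignoresLargest {V : Type*} (f : ℕ) (B : Finset V) (d : V → ℝ) :
    ∃ H, IgnoresLargest f B d H := by
  classical
  by_cases h : (B.filter (fun j => 0 ≤ d j)).card < f
  · refine ⟨B.filter (fun j => 0 ≤ d j), Finset.filter_subset _ _, ?_⟩
    rw [if_pos (by convert h)]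
  · have hf : f ≤ B.card := (not_lt.1 h).trans (Finset.card_filter_le _ _)
    -- Sets of n largest values are built greedily, by adding a maximum of the rest.
    have key : ∀ n ≤ B.card, ∃ H ⊆ B, H.card = n ∧ ∀ j ∈ H, ∀ l ∈ B \ H, d l ≤ d j := by
      intro n
      induction n with
      | zero => exact fun _ => ⟨∅, by simp, by simp, by simp⟩
      | succ n ih =>
        intro hn
        obtain ⟨H, hHB, hHc, hH⟩ := ih (by omega)
        have hne : (B \ H).Nonempty := by
          have := Finset.le_card_sdiff H B
          exact Finset.card_pos.1 (by omega)
        obtain ⟨m, hm, hmax⟩ := (B \ H).exists_max_image d hne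
        rw [Finset.mem_sdiff] at hm
        refine ⟨insert m H, Finset.insert_subset hm.1 hHB, by
          rw [Finset.card_insert_of_notMem hm.2, hHc], ?_⟩
        intro j hj l hl
        simp only [Finset.mem_sdiff, Finset.mem_insert, not_or] at hl hj
        rcases hj with rfl | hj
        · exact hmax l (by simp [hl])
        · exact hH j hj l (by simp [hl])
    obtain ⟨H, hHB, hHc, hH⟩ := key f hf
    refine ⟨H, hHB, ?_⟩
    rw [if_neg (by convert h)]
    refine ⟨hHc, fun j hj l hl => hH j hj l ?_⟩
    simpa using hl

theorem exists_ignoresExtremes {V : Type*} (f : ℕ) (B : Finset V) (d : V → ℝ) :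
    ∃ S, IgnoresExtremes f B d S := by
  obtain ⟨H, hH⟩ := exists_ignoresLargest f B d
  obtain ⟨L, hL⟩ := exists_ignoresLargest f B (fun j => - d j)
  exact ⟨_, H, L, hH, hL, rfl⟩

/-! ### Contraction of the filtered system -/

/-- The normal vehicles of a run in transformed coordinates `P`, `Q`, where `Z i j k` is the value
that `i` uses for the position of its neighbour `j` at time `k`. -/
structure FilteredSystem {V : Type*} [DecidableEq V] (B : V → Finset V) (M : Finset V) (f τ : ℕ)
    (T : ℝ) (α : V → ℝ) (a : ℕ → V → V → ℝ) (P Q : V → ℤ → ℝ) (U : V → ℤ → ℝ)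
    (Z : V → V → ℤ → ℝ) (ign : V → ℤ → Finset V) : Prop where
  pos : ∀ i ∉ M, ∀ k : ℕ, P i (k + 1) = P i k + T * Q i k + T ^ 2 / 2 * U i k
  vel : ∀ i ∉ M, ∀ k : ℕ, Q i (k + 1) = Q i k + T * U i k
  control : ∀ i ∉ M, ∀ k : ℕ,
    U i k = ∑ j ∈ B i \ ign i k, a k i j * (Z i j k - P i k) - α i * Q i k
  value : ∀ i ∉ M, ∀ k : ℕ, ∀ j ∈ B i, j ∉ M → ∃ l : ℤ, k - τ ≤ l ∧ l ≤ k ∧ Z i j k = P j l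
  filter : ∀ i ∉ M, ∀ k : ℕ, (B i).Nonempty → ∃ t : ℤ, k - τ ≤ t ∧ t ≤ k ∧
    IgnoresExtremes f (B i) (fun j => Z i j k - P i t) (ign i k)

namespace FilteredSystem

variable {V : Type*} [DecidableEq V] {B : V → Finset V} {M : Finset V} {f τ : ℕ}
  {T : ℝ} {α : V → ℝ} {a : ℕ → V → V → ℝ} {P Q : V → ℤ → ℝ} {U : V → ℤ → ℝ}
  {Z : V → V → ℤ → ℝ} {ign : V → ℤ → Finset V}

/-- Reflection exchanges upper and lower bounds, so the estimates below are needed for one side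
only. -/
theorem neg (h : FilteredSystem B M f τ T α a P Q U Z ign) :
    FilteredSystem B M f τ T α a (fun i k => - P i k) (fun i k => - Q i k) (fun i k => - U i k)
      (fun i j k => - Z i j k) ign where
  pos i hi k := by rw [h.pos i hi]; ring
  vel i hi k := by rw [h.vel i hi]; ring
  control i hi k := by
    have : ∑ j ∈ B i \ ign i k, a k i j * (- Z i j k - - P i k) =
        - ∑ j ∈ B i \ ign i k, a k i j * (Z i j k - P i k) := by
      rw [← Finset.sum_neg_distrib]
      exact Finset.sum_congr rfl fun j _ => by ring
    rw [this, h.control i hi]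
    ring
  value i hi k j hj hjM := by
    obtain ⟨l, h1, h2, h3⟩ := h.value i hi k j hj hjM
    exact ⟨l, h1, h2, by rw [h3]⟩
  filter i hi k hB := by
    obtain ⟨t, h1, h2, h3⟩ := h.filter i hi k hB
    refine ⟨t, h1, h2, ?_⟩
    convert h3.neg using 2
    ring

/-- At time `k`, the state and the recent positions of all normal vehicles are below `b`. -/
def Below (M : Finset V) (τ : ℕ) (c : V → ℝ) (P Q : V → ℤ → ℝ) (b : ℝ) (k : ℕ) : Prop :=
  ∀ i ∉ M, (∀ l : ℤ, k - τ ≤ l → l ≤ k → P i l ≤ b) ∧ P i k + c i * Q i k ≤ b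

/-- The used values of the neighbours are bounded by the recent positions of normal vehicles. -/
theorem used_le (h : FilteredSystem B M f τ T α a P Q U Z ign) (hM : M.card ≤ f) {i : V}
    (hi : i ∉ M) {k : ℕ} {b : ℝ} (hb : ∀ j ∉ M, ∀ l : ℤ, k - τ ≤ l → l ≤ k → P j l ≤ b) {j : V}
    (hj : j ∈ B i \ ign i k) : Z i j k ≤ b := by
  -- The filter compared the values with the position of `i` at time t, not k. As t lies in the
  -- window, that position is also at most b, so the threshold b - P i t is nonnegative as
  -- `le_bound` requires.
  obtain ⟨t, h1, h2, h3⟩ := h.filter i hi k ⟨j, (Finset.mem_sdiff.1 hj).1⟩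
  have := h3.le_bound hM (sub_nonneg.2 (hb i hi t h1 h2)) (fun l hl hlM => ?_) hj
  · linarith
  · obtain ⟨s, h4, h5, h6⟩ := h.value i hi k l hl hlM
    rw [h6]
    linarith [hb l hlM s h4 h5]

theorem exists_used_le (h : FilteredSystem B M f τ T α a P Q U Z ign) (hM : M.card ≤ f) {i : V}
    (hi : i ∉ M) {k : ℕ} {b : ℝ} {A : Finset V} (hA : A ⊆ B i) (hAc : 2 * f + 1 ≤ A.card)
    (hb : ∀ j ∈ A, j ∉ M → ∀ l : ℤ, k - τ ≤ l → l ≤ k → P j l ≤ b) :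
    ∃ j ∈ B i \ ign i k, Z i j k ≤ b := by
  have hne : A.Nonempty := Finset.card_pos.1 (by omega)
  obtain ⟨t, h1, h2, h3⟩ := h.filter i hi k (hne.mono hA)
  have hX : ∀ l ∈ A, l ∉ M → Z i l k - P i t ≤ b - P i t := by
    intro l hl hlM
    obtain ⟨s, h4, h5, h6⟩ := h.value i hi k l (hA hl) hlM
    rw [h6]
    linarith [hb l hl hlM s h4 h5]
  obtain ⟨j, hj, hjb⟩ := h3.exists_le hM hA hAc hX
  exact ⟨j, hj, by linarith⟩

variable {c S : V → ℝ} {γ η : ℝ}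

/-- Retained values satisfy the bound b by `used_le`, and dropping edges with nonnegative weights
keeps the total weight below `S i`. -/
theorem step (h : FilteredSystem B M f τ T α a P Q U Z ign) (hM : M.card ≤ f)
    (hs : ∀ i, StepBound V T (α i) (S i) γ (c i) η) (hγ : 0 ≤ γ)
    (ha : ∀ (k : ℕ) i, ∀ j ∈ B i, γ ≤ a k i j) (hS : ∀ (k : ℕ) i, ∑ j ∈ B i, a k i j ≤ S i)
    {b : ℝ} {k : ℕ} (hb : Below M τ c P Q b k) {i : V} (hi : i ∉ M) :
    P i (k + 1) ≤ b - η * (b - (P i k + c i * Q i k)) ∧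
    P i (k + 1) + c i * Q i (k + 1) ≤ b - η * (b - (P i k + c i * Q i k)) ∧
    ∀ j ∈ B i \ ign i k, P i (k + 1) + c i * Q i (k + 1) ≤ b - η * (b - Z i j k) := by
  rw [h.pos i hi, h.vel i hi]
  refine hs i (B i \ ign i k) (a k i) (fun j => Z i j k) (P i k) (Q i k) (U i k) b
    (fun j hj => ha k i j (Finset.mem_sdiff.1 hj).1) ?_ ((hb i hi).1 k (by simp) le_rfl)
    (hb i hi).2 (fun j hj => h.used_le hM hi (fun j hj => (hb j hj).1) hj) (h.control i hi k)
  exact (Finset.sum_le_sum_of_subset_of_nonneg Finset.sdiff_subset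
    fun j hj _ => hγ.trans (ha k i j hj)).trans (hS k i)

section

variable (h : FilteredSystem B M f τ T α a P Q U Z ign) (hM : M.card ≤ f)
  (hs : ∀ i, StepBound V T (α i) (S i) γ (c i) η) (hγ : 0 ≤ γ)
  (ha : ∀ (k : ℕ) i, ∀ j ∈ B i, γ ≤ a k i j) (hS : ∀ (k : ℕ) i, ∑ j ∈ B i, a k i j ≤ S i)
  (hη : 0 < η) (hη1 : η < 1)

include h hM hs hγ ha hS hη

/-- The one-step estimate subtracts a nonnegative amount from b, and the window gains only the new
position. -/
theorem below_add {b : ℝ} {k : ℕ} (hb : Below M τ c P Q b k) (n : ℕ) :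
    Below M τ c P Q b (k + n) := by
  induction n with
  | zero => exact hb
  | succ n ih =>
    intro i hi
    obtain ⟨h1, h2, -⟩ := h.step hM hs hγ ha hS ih hi
    have h0 : 0 ≤ η * (b - (P i (k + n : ℕ) + c i * Q i (k + n : ℕ))) :=
      mul_nonneg hη.le (sub_nonneg.2 (ih i hi).2)
    rw [← add_assoc]
    refine ⟨fun l hl hl' => ?_, ?_⟩
    · rcases hl'.lt_or_eq with hlt | rfl
      · exact (ih i hi).1 l (by push_cast at *; omega) (by push_cast at *; omega)
      · rw [Nat.cast_add_one]; linarith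
    · rw [Nat.cast_add_one]; linarith

/-- A distance of the state of `i` to an upper bound of all vehicles decays at most
geometrically. -/
theorem state_add_le {b ε : ℝ} {k : ℕ} (hb : Below M τ c P Q b k) {i : V} (hi : i ∉ M)
    (hε : P i k + c i * Q i k ≤ b - ε) (n : ℕ) :
    P i (k + n : ℕ) + c i * Q i (k + n : ℕ) ≤ b - η ^ n * ε ∧
    P i ((k + n : ℕ) + 1) ≤ b - η ^ (n + 1) * ε := by
  have key : P i (k + n : ℕ) + c i * Q i (k + n : ℕ) ≤ b - η ^ n * ε := by
    induction n with
    | zero => simpa using hε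
    | succ n ih =>
      obtain ⟨-, h2, -⟩ := h.step hM hs hγ ha hS (h.below_add hM hs hγ ha hS hη hb n) hi
      rw [← add_assoc, Nat.cast_add_one (k + n), pow_succ']
      have := mul_le_mul_of_nonneg_left ih hη.le
      linarith
  refine ⟨key, ?_⟩
  obtain ⟨h1, -, -⟩ := h.step hM hs hγ ha hS (h.below_add hM hs hγ ha hS hη hb n) hi
  rw [pow_succ']
  have := mul_le_mul_of_nonneg_left key hη.le
  linarith

include hη1

/-- A gap of y at time k reaches the position only one step later, so the window starts at k + 1. At
time k + τ + 1 every admissible delayed value lies in it. -/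
theorem pos_le_of_window {b ε : ℝ} {k : ℕ} (hε : 0 ≤ ε) (hb : Below M τ c P Q b k) {i : V}
    (hi : i ∉ M) (hiε : P i k + c i * Q i k ≤ b - ε) {l : ℤ} (hl : k + 1 ≤ l)
    (hl' : l ≤ (k + τ + 1 : ℕ)) : P i l ≤ b - η ^ (τ + 1) * ε := by
  obtain ⟨n, rfl⟩ : ∃ n : ℕ, l = (k + n : ℕ) + 1 := ⟨(l - k - 1).toNat, by omega⟩
  have h1 := (h.state_add_le hM hs hγ ha hS hη hb hi hiε n).2
  have h2 : η ^ (τ + 1) * ε ≤ η ^ (n + 1) * ε :=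
    mul_le_mul_of_nonneg_right (pow_le_pow_of_le_one hη.le hη1.le (by push_cast at *; omega)) hε
  linarith

/-- If all states are below `b - ε`, then so is, up to a factor, everything after a delay. -/
theorem below_of_state_le {b ε : ℝ} {k : ℕ} (hε : 0 ≤ ε) (hb : Below M τ c P Q b k)
    (hall : ∀ i ∉ M, P i k + c i * Q i k ≤ b - ε) :
    Below M τ c P Q (b - η ^ (τ + 1) * ε) (k + (τ + 1)) := by
  refine fun i hi => ⟨fun l hl hl' => ?_, (h.state_add_le hM hs hγ ha hS hη hb hi (hall i hi) _).1⟩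
  exact h.pos_le_of_window hM hs hγ ha hS hη hη1 hε hb hi (hall i hi)
    (by push_cast at *; omega) (by push_cast at *; omega)

/-- A vehicle with enough neighbours outside of `A` is pulled away from the bound if the normal
vehicles outside of `A` are away from it. -/
theorem state_le_of_neighbors {b ε : ℝ} {k : ℕ} (hε : 0 ≤ ε) (hb : Below M τ c P Q b k) {i : V}
    (hi : i ∉ M) {A : Finset V} (hA : 2 * f + 1 ≤ (B i \ A).card)
    (hout : ∀ j ∉ M, j ∉ A → P j k + c j * Q j k ≤ b - ε) :
    P i (k + (τ + 2) : ℕ) + c i * Q i (k + (τ + 2) : ℕ) ≤ b - η ^ (τ + 2) * ε := by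
  -- The τ + 1 steps clear old values from the window; one further step transfers the gap to y of
  -- `i`.
  obtain ⟨j, hj, hjb⟩ := h.exists_used_le hM (k := k + τ + 1) hi Finset.sdiff_subset hA
    (b := b - η ^ (τ + 1) * ε) (fun j hj hjM l hl hl' =>
      h.pos_le_of_window hM hs hγ ha hS hη hη1 hε hb hjM
        (hout j hjM (Finset.mem_sdiff.1 hj).2) (by push_cast at *; omega) hl')
  have h1 := (h.step hM hs hγ ha hS (h.below_add hM hs hγ ha hS hη hb (τ + 1)) hi).2.2 j hj
  have e : ((k + (τ + 2) : ℕ) : ℤ) = ((k + (τ + 1) : ℕ) : ℤ) + 1 := by push_cast; ring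
  rw [e]
  have h2 := mul_le_mul_of_nonneg_left hjb hη.le
  rw [pow_succ' η (τ + 1)]
  simp only [add_assoc] at h1 h2 ⊢
  linarith

/-- Robustness lets one of the two groups of vehicles lose all its members. -/
theorem exists_side [Fintype V] {m b : ℝ}
    (hrob : ∀ A₁ A₂ : Finset V, A₁.Nonempty → A₂.Nonempty → Disjoint A₁ A₂ →
      (∃ i ∈ A₁, 2 * f + 1 ≤ (B i \ A₁).card) ∨ ∃ i ∈ A₂, 2 * f + 1 ≤ (B i \ A₂).card)
    (n : ℕ) : ∀ (k : ℕ) (ε : ℝ) (A₁ A₂ : Finset V), 0 ≤ ε → Below M τ c P Q b k →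
      Below M τ c (fun i k => - P i k) (fun i k => - Q i k) (-m) k → Disjoint A₁ A₂ →
      A₁.card + A₂.card ≤ n →
      (∀ i ∉ M, i ∉ A₁ → P i k + c i * Q i k ≤ b - ε) →
      (∀ i ∉ M, i ∉ A₂ → m + ε ≤ P i k + c i * Q i k) →
      (∀ i ∉ M, P i (k + n * (τ + 2) : ℕ) + c i * Q i (k + n * (τ + 2) : ℕ)
        ≤ b - η ^ (n * (τ + 2)) * ε) ∨
      ∀ i ∉ M, m + η ^ (n * (τ + 2)) * ε
        ≤ P i (k + n * (τ + 2) : ℕ) + c i * Q i (k + n * (τ + 2) : ℕ) := by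
  -- Invariant: outside `A₁` normal vehicles keep a gap to b, outside `A₂` to m. Each round of τ + 2
  -- steps removes one vehicle and scales the gap by η ^ (τ + 2).
  have hup {b ε : ℝ} {k : ℕ} (hb : Below M τ c P Q b k) {i : V} (hi : i ∉ M)
      (hε : P i k + c i * Q i k ≤ b - ε) (n : ℕ) :=
    (h.state_add_le hM hs hγ ha hS hη hb hi hε n).1
  have hlo {m ε : ℝ} {k : ℕ} (hb : Below M τ c (fun i k => - P i k) (fun i k => - Q i k) (-m) k)
      {i : V} (hi : i ∉ M) (hε : m + ε ≤ P i k + c i * Q i k) (n : ℕ) :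
      m + η ^ n * ε ≤ P i (k + n : ℕ) + c i * Q i (k + n : ℕ) := by
    have := (h.neg.state_add_le hM hs hγ ha hS hη hb hi (ε := ε) (by linarith) n).1
    linarith
  induction n with
  | zero =>
    intro k ε A₁ A₂ hε hb hm hd hc h1 h2
    left
    intro i hi
    have : A₁ = ∅ := Finset.card_eq_zero.1 (by omega)
    simpa using h1 i hi (by simp [this])
  | succ n ih =>
    intro k ε A₁ A₂ hε hb hm hd hc h1 h2
    rcases A₁.eq_empty_or_nonempty with rfl | hne₁
    · exact .inl fun i hi => hup hb hi (h1 i hi (by simp)) _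
    rcases A₂.eq_empty_or_nonempty with rfl | hne₂
    · exact .inr fun i hi => hlo hm hi (h2 i hi (by simp)) _
    have e1 : k + (n + 1) * (τ + 2) = k + (τ + 2) + n * (τ + 2) := by ring
    have e2 : η ^ ((n + 1) * (τ + 2)) * ε = η ^ (n * (τ + 2)) * (η ^ (τ + 2) * ε) := by
      rw [← mul_assoc, ← pow_add]; congr 2; ring
    rw [e1, e2]
    have hb' := h.below_add hM hs hγ ha hS hη hb (τ + 2)
    have hm' := h.neg.below_add hM hs hγ ha hS hη hm (τ + 2)
    have hε' : 0 ≤ η ^ (τ + 2) * ε := by positivity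
    rcases hrob A₁ A₂ hne₁ hne₂ hd with ⟨i, hi, hiA⟩ | ⟨i, hi, hiA⟩
    -- If `i` is malicious it may leave the group at no cost, as the gaps concern normal vehicles
    -- only.
    · refine ih (k + (τ + 2)) _ (A₁.erase i) A₂ hε' hb' hm'
        (hd.mono_left (Finset.erase_subset _ _)) ?_ (fun j hj hjA => ?_)
        (fun j hj hjA => hlo hm hj (h2 j hj hjA) _)
      · have := Finset.card_erase_lt_of_mem hi; omega
      · by_cases hji : j = i
        · subst hji
          exact h.state_le_of_neighbors hM hs hγ ha hS hη hη1 hε hb hj hiA h1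
        · exact hup hb hj (h1 j hj (by simpa [hji] using hjA)) _
    · refine ih (k + (τ + 2)) _ A₁ (A₂.erase i) hε' hb' hm'
        (hd.mono_right (Finset.erase_subset _ _)) ?_ (fun j hj hjA => hup hb hj (h1 j hj hjA) _)
        (fun j hj hjA => ?_)
      · have := Finset.card_erase_lt_of_mem hi; omega
      · by_cases hji : j = i
        · subst hji
          have := h.neg.state_le_of_neighbors hM hs hγ ha hS hη hη1 hε hm hj hiA
            (fun l hl hlA => by linarith [h2 l hl hlA])
          linarith
        · exact hlo hm hj (h2 j hj (by simpa [hji] using hjA)) _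

/-- The spread of the normal vehicles contracts over a fixed period. -/
theorem contraction [Fintype V] {m b : ℝ}
    (hrob : ∀ A₁ A₂ : Finset V, A₁.Nonempty → A₂.Nonempty → Disjoint A₁ A₂ →
      (∃ i ∈ A₁, 2 * f + 1 ≤ (B i \ A₁).card) ∨ ∃ i ∈ A₂, 2 * f + 1 ≤ (B i \ A₂).card)
    {L : ℕ} (hL : L = Fintype.card V * (τ + 2) + (τ + 1)) {k : ℕ} (hmb : m ≤ b)
    (hb : Below M τ c P Q b k)
    (hm : Below M τ c (fun i k => - P i k) (fun i k => - Q i k) (-m) k) :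
    ∃ m' b' : ℝ, m' ≤ b' ∧ b' - m' = (1 - η ^ L / 2) * (b - m) ∧
      Below M τ c P Q b' (k + L) ∧
      Below M τ c (fun i k => - P i k) (fun i k => - Q i k) (-m') (k + L) := by
  set N := Fintype.card V * (τ + 2) with hN
  have hε : 0 ≤ (b - m) / 2 := by linarith
  have hp : η ^ L / 2 ≤ 1 := by linarith [pow_le_one₀ (n := L) hη.le hη1.le]
  have hε' : 0 ≤ η ^ N * ((b - m) / 2) := by positivity
  have e : η ^ L = η ^ (τ + 1) * η ^ N := by rw [hL, pow_add, mul_comm]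
  have hw : 0 ≤ (1 - η ^ L / 2) * (b - m) := mul_nonneg (by linarith) (by linarith)
  -- With ε half the width, b - ε = m + ε is the midpoint, so the two groups partition all vehicles,
  -- malicious ones included.
  have hside := h.exists_side hM hs hγ ha hS hη hη1 hrob (Fintype.card V) k ((b - m) / 2)
    (Finset.univ.filter fun i => b - (b - m) / 2 < P i k + c i * Q i k)
    (Finset.univ.filter fun i => ¬ b - (b - m) / 2 < P i k + c i * Q i k) hε hb hm
    (Finset.disjoint_filter_filter_not _ _ _)
    (by rw [Finset.card_filter_add_card_filter_not, Finset.card_univ])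
    (fun i _ hi => by simpa using hi) (fun i _ hi => by
      simp only [Finset.mem_filter, Finset.mem_univ, true_and, not_not] at hi
      linarith)
  rw [← hN] at hside
  rcases hside with hside | hside
  · have h1 := h.below_of_state_le hM hs hγ ha hS hη hη1 hε' (h.below_add hM hs hγ ha hS hη hb N)
      hside
    have h2 := h.neg.below_add hM hs hγ ha hS hη hm L
    rw [add_assoc, ← hL] at h1
    have ew : b - η ^ (τ + 1) * (η ^ N * ((b - m) / 2)) - m = (1 - η ^ L / 2) * (b - m) := by
      rw [e]; ring
    exact ⟨m, _, by linarith, ew, h1, h2⟩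
  · have h1 := h.neg.below_of_state_le hM hs hγ ha hS hη hη1 hε'
      (h.neg.below_add hM hs hγ ha hS hη hm N) (fun i hi => by linarith [hside i hi])
    have h2 := h.below_add hM hs hγ ha hS hη hb L
    rw [add_assoc, ← hL] at h1
    have ew : b - (m + η ^ (τ + 1) * (η ^ N * ((b - m) / 2))) = (1 - η ^ L / 2) * (b - m) := by
      rw [e]; ring
    refine ⟨_, b, by linarith, ew, h2, ?_⟩
    convert h1 using 1
    ring

/-- The initial history and states of the finitely many vehicles fit into some [-D, D]. The width
contracts once per period L, and the remaining k % L steps are covered by invariance. -/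
theorem exists_width [Fintype V]
    (hrob : ∀ A₁ A₂ : Finset V, A₁.Nonempty → A₂.Nonempty → Disjoint A₁ A₂ →
      (∃ i ∈ A₁, 2 * f + 1 ≤ (B i \ A₁).card) ∨ ∃ i ∈ A₂, 2 * f + 1 ≤ (B i \ A₂).card)
    {L : ℕ} (hL : L = Fintype.card V * (τ + 2) + (τ + 1)) :
    ∃ w : ℝ, 0 ≤ w ∧ ∀ k : ℕ, ∃ m b : ℝ, m ≤ b ∧ b - m = (1 - η ^ L / 2) ^ (k / L) * w ∧
      Below M τ c P Q b k ∧
      Below M τ c (fun i k => - P i k) (fun i k => - Q i k) (-m) k := by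
  obtain ⟨D, hD0, hD⟩ : ∃ D : ℝ, 0 ≤ D ∧ ∀ i, (∀ l : ℤ, - τ ≤ l → l ≤ 0 → |P i l| ≤ D) ∧
      |P i 0 + c i * Q i 0| ≤ D := by
    refine ⟨∑ i, (∑ l ∈ Finset.Icc (-τ : ℤ) 0, |P i l| + |P i 0 + c i * Q i 0|), by positivity,
      fun i => ?_⟩
    have h0 := Finset.single_le_sum
      (f := fun i => ∑ l ∈ Finset.Icc (-τ : ℤ) 0, |P i l| + |P i 0 + c i * Q i 0|)
      (fun i _ => by positivity) (Finset.mem_univ i)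
    have hnn : 0 ≤ ∑ l ∈ Finset.Icc (-τ : ℤ) 0, |P i l| := by positivity
    refine ⟨fun l hl hl' => ?_, by linarith⟩
    have h1 := Finset.single_le_sum (f := fun l => |P i l|) (s := Finset.Icc (-τ : ℤ) 0)
      (fun i _ => by positivity) (Finset.mem_Icc.2 ⟨hl, hl'⟩)
    linarith [abs_nonneg (P i 0 + c i * Q i 0)]
  have hperiod : ∀ n : ℕ, ∃ m b : ℝ, m ≤ b ∧ b - m = (1 - η ^ L / 2) ^ n * (2 * D) ∧
      Below M τ c P Q b (L * n) ∧
      Below M τ c (fun i k => - P i k) (fun i k => - Q i k) (-m) (L * n) := by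
    intro n
    induction n with
    | zero =>
      refine ⟨-D, D, by linarith, by ring, fun i _ => ?_, fun i _ => ?_⟩
      · obtain ⟨h1, h2⟩ := hD i
        refine ⟨fun l hl hl' => ?_, by simpa using (abs_le.1 h2).2⟩
        exact (abs_le.1 (h1 l (by simpa using hl) (by simpa using hl'))).2
      · obtain ⟨h1, h2⟩ := hD i
        refine ⟨fun l hl hl' => ?_, ?_⟩
        · have := (abs_le.1 (h1 l (by simpa using hl) (by simpa using hl'))).1
          linarith
        · simp only [mul_zero, Nat.cast_zero]
          linarith [(abs_le.1 h2).1]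
    | succ n ih =>
      obtain ⟨m, b, h1, h2, h3, h4⟩ := ih
      obtain ⟨m', b', h5, h6, h7, h8⟩ := h.contraction hM hs hγ ha hS hη hη1 hrob hL h1 h3 h4
      exact ⟨m', b', h5, by rw [h6, h2]; ring, h7, h8⟩
  refine ⟨2 * D, by linarith, fun k => ?_⟩
  obtain ⟨m, b, h1, h2, h3, h4⟩ := hperiod (k / L)
  have h5 := h.below_add hM hs hγ ha hS hη h3 (k % L)
  have h6 := h.neg.below_add hM hs hγ ha hS hη h4 (k % L)
  rw [Nat.div_add_mod] at h5 h6
  exact ⟨m, b, h1, h2, h5, h6⟩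

end

end FilteredSystem

/-! ### From runs to the filtered system, and the exponential rate -/

/-- The last update before the present time and the delays are both recent. -/
theorem IsRun.exists_update {V : Type*} [Fintype V] {N : VehicleNetwork V} {M : Finset V}
    {e : NetworkRun V} (h : IsRun N M e) {i : V} (hi : i ∉ M) (hne : (inNeighbors N.G i).Nonempty)
    (k : ℤ) : ∃ t : ℤ, k - N.τ ≤ t ∧ t ≤ k ∧ t ∈ e.upd i ∧ e.ignored i k = e.ignored i t ∧
      ∀ j ∈ inNeighbors N.G i, k - (e.delay i j k : ℤ) = t - (e.delay i j t : ℤ) := by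
  have key : ∀ n : ℕ, (∃ t : ℤ, k - n < t ∧ t ≤ k ∧ t ∈ e.upd i ∧
      e.ignored i k = e.ignored i t ∧
      ∀ j ∈ inNeighbors N.G i, k - (e.delay i j k : ℤ) = t - (e.delay i j t : ℤ)) ∨
      e.ignored i k = e.ignored i (k - n) ∧
      ∀ j ∈ inNeighbors N.G i, e.delay i j k = e.delay i j (k - n) + n := by
    intro n
    induction n with
    | zero => exact .inr (by simp)
    | succ n ih =>
      rcases ih with ⟨t, h1, h2⟩ | ⟨h1, h2⟩
      · exact .inl ⟨t, by push_cast; omega, h2⟩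
      · by_cases hu : k - n ∈ e.upd i
        · exact .inl ⟨k - n, by push_cast; omega, by omega, hu, h1, fun j hj => by
            rw [h2 j hj]; push_cast; ring⟩
        · obtain ⟨h3, h4⟩ := h.hold i hi _ hu
          have e1 : k - ((n + 1 : ℕ) : ℤ) = k - n - 1 := by push_cast; ring
          refine .inr ⟨by rw [e1, h1, h3], fun j hj => ?_⟩
          rw [e1, h2 j hj, h4 j hj]
          ring
  -- With τ + 1 consecutive steps without an update, the delay of any neighbour would exceed τ.
  rcases key (N.τ + 1) with ⟨t, h1, h2⟩ | ⟨-, h2⟩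
  · exact ⟨t, by push_cast at h1; omega, h2⟩
  · obtain ⟨j, hj⟩ := hne
    have h3 := h.delay_le i hi j hj k
    rw [h2 j hj] at h3
    omega

open Classical in
/-- The normal vehicles of a run, in coordinates in which all desired relative positions vanish. -/
theorem IsRun.filteredSystem {V : Type*} [Fintype V] {N : VehicleNetwork V} {M : Finset V}
    {e : NetworkRun V} (h : IsRun N M e) (hδ : ∀ i j l, N.δ i j + N.δ j l = N.δ i l) (o : V) :
    FilteredSystem (inNeighbors N.G) M N.f N.τ N.T N.α N.a (fun i k => e.p N i k - N.δ o i)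
      (fun i k => e.q N i k) e.u
      (fun i j k => e.pSeen N i j (k - (e.delay i j k : ℤ)) - N.δ o j) e.ignored where
  pos i _ k := by
    simp only [NetworkRun.p, NetworkRun.q, h.position i k]
    push_cast
    ring
  vel i _ k := by
    simp only [NetworkRun.q, h.velocity i k]
    ring
  control i hi k := by
    rw [h.control i hi k]
    congr 1
    exact Finset.sum_congr (by congr) fun j _ => by
      rw [NetworkRun.rel, ← hδ o i j]; ring
  value i hi k j hj hjM := by
    refine ⟨k - (e.delay i j k : ℤ), ?_, by omega, ?_⟩
    · have := h.delay_le i hi j hj k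
      omega
    · simp only [NetworkRun.p, NetworkRun.pSeen, h.truthful i j _ (.inl hjM)]
  filter i hi k hne := by
    obtain ⟨t, h1, h2, h3, h4, h5⟩ := h.exists_update hi hne k
    refine ⟨t, h1, h2, ?_⟩
    have hd : ∀ j ∈ inNeighbors N.G i, e.rel N i j t =
        e.pSeen N i j (k - (e.delay i j k : ℤ)) - N.δ o j - (e.p N i t - N.δ o i) := by
      intro j hj
      rw [NetworkRun.rel, h5 j hj, ← hδ o i j]; ring
    rw [h4]
    exact (h.update i hi t h3).congr hd

/-- For s = 1, each of the three alternatives makes one of the two reachable sets nonempty. -/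
theorem IsRobust.exists_neighbors {V : Type*} [Fintype V] [DecidableEq V] {G : Digraph V} {r : ℕ}
    (h : IsRobust G r 1) (A₁ A₂ : Finset V) (h₁ : A₁.Nonempty) (h₂ : A₂.Nonempty)
    (hd : Disjoint A₁ A₂) :
    (∃ i ∈ A₁, r ≤ (inNeighbors G i \ A₁).card) ∨ ∃ i ∈ A₂, r ≤ (inNeighbors G i \ A₂).card := by
  have key : ∀ A : Finset V, (reachable G r A).Nonempty →
      ∃ i ∈ A, r ≤ (inNeighbors G i \ A).card := by
    rintro A ⟨i, hi⟩
    rw [reachable, Finset.mem_filter] at hi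
    refine ⟨i, hi.1, ?_⟩
    convert hi.2
  rcases h.2.2 A₁ A₂ h₁ h₂ hd with h | h | h
  · exact .inl (key _ (h.symm ▸ h₁))
  · exact .inr (key _ (h.symm ▸ h₂))
  · rcases (reachable G r A₁).eq_empty_or_nonempty with h0 | h0
    · refine .inr (key _ (Finset.card_pos.1 ?_))
      rw [h0, Finset.card_empty] at h
      omega
    · exact .inl (key _ h0)

theorem exponentialRate_of_isRobust {V : Type*} [Fintype V] {N : VehicleNetwork V}
    (hN : WellPosed N) (hgain : GainCondition N) (hrob : IsRobust N.G (2 * N.f + 1) 1) :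
    ExponentialRate N := by
  classical
  obtain ⟨hT, hα, hδ, γ, hγ, ha⟩ := hN
  have : Nonempty V := Fintype.card_pos_iff.1 (by have := hrob.1; omega)
  obtain ⟨o⟩ := this
  have ha' : ∀ (k : ℕ) i, ∀ j ∈ inNeighbors N.G i, γ ≤ N.a k i j := fun k i j hj =>
    ha k i j (by simpa [inNeighbors] using hj)
  choose S hS h1 h2 using hgain
  have hS0 : ∀ i, 0 ≤ S i := fun i =>
    (Finset.sum_nonneg fun j hj => hγ.le.trans (ha' 0 i j hj)).trans (hS i 0)
  choose c η' hc hη' hs using fun i =>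
    exists_stepBound V hT (hα i) (hS0 i) hγ (h1 i) (h2 i)
  obtain ⟨η, hη, hη1, hs⟩ : ∃ η : ℝ, 0 < η ∧ η < 1 ∧
      ∀ i, StepBound V N.T (N.α i) (S i) γ (c i) η := by
    refine ⟨min (1 / 2) (Finset.univ.inf' (Finset.univ_nonempty_iff.2 ⟨o⟩) η'), ?_, ?_, fun i => ?_⟩
    · exact lt_min (by norm_num) ((Finset.lt_inf'_iff _).2 fun i _ => hη' i)
    · exact (min_le_left _ _).trans_lt (by norm_num)
    · exact (hs i).mono ((min_le_right _ _).trans (Finset.inf'_le _ (Finset.mem_univ i)))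
  set L := Fintype.card V * (N.τ + 2) + (N.τ + 1) with hL
  have hL0 : L ≠ 0 := by omega
  set θ := 1 - η ^ L / 2 with hθ
  have hp0 : 0 < η ^ L := by positivity
  have hp1 : η ^ L ≤ 1 := pow_le_one₀ hη.le hη1.le
  have hθ0 : 0 < θ := by linarith
  have hθ1 : θ < 1 := by linarith
  set ρ := θ ^ ((L : ℝ)⁻¹) with hρ
  have hρ0 : 0 < ρ := Real.rpow_pos_of_pos hθ0 _
  have hρ1 : ρ < 1 := Real.rpow_lt_one hθ0.le hθ1 (by positivity)
  have hρL : ρ ^ L = θ := Real.rpow_inv_natCast_pow hθ0.le hL0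
  -- The factor θ⁻¹ pays for the incomplete last period, since ρ ^ (k % L) ≥ ρ ^ L = θ.
  have hdecay : ∀ k : ℕ, θ ^ (k / L) ≤ θ⁻¹ * ρ ^ k := by
    intro k
    have e : ρ ^ k = θ ^ (k / L) * ρ ^ (k % L) := by
      rw [← hρL, ← pow_mul, ← pow_add, Nat.div_add_mod]
    have h3 : θ ≤ ρ ^ (k % L) := by
      rw [← hρL]
      exact pow_le_pow_of_le_one hρ0.le hρ1.le (Nat.mod_lt _ (by omega)).le
    rw [le_inv_mul_iff₀ hθ0, e, mul_comm]
    gcongr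
  refine ⟨ρ, hρ0, hρ1, fun M hM e he => ?_⟩
  have hsys := he.filteredSystem hδ o
  obtain ⟨w, hw, hwidth⟩ := hsys.exists_width hM hs hγ.le ha' (fun k i => hS i k) hη hη1
    hrob.exists_neighbors hL
  have hsum : ∀ i, (c i)⁻¹ ≤ ∑ j, (c j)⁻¹ := fun i =>
    Finset.single_le_sum (f := fun j => (c j)⁻¹) (fun j _ => (inv_pos.2 (hc j)).le)
      (Finset.mem_univ i)
  have hsum0 : 0 ≤ ∑ j, (c j)⁻¹ := (inv_pos.2 (hc o)).le.trans (hsum o)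
  -- The summand 1 serves the positions, and the sum of the 1 / c serves the velocities through c
  -- |q| = |y - p|.
  refine ⟨(1 + ∑ j, (c j)⁻¹) * (θ⁻¹ * w), fun k => ?_⟩
  obtain ⟨m, b, hmb, hbm, hb, hm⟩ := hwidth k
  have hW : b - m ≤ θ⁻¹ * w * ρ ^ k := by
    rw [hbm]
    calc θ ^ (k / L) * w ≤ θ⁻¹ * ρ ^ k * w := by gcongr; exact hdecay k
      _ = _ := by ring
  have hW0 : 0 ≤ θ⁻¹ * w * ρ ^ k := by positivity
  have hpos : ∀ i ∉ M, m ≤ e.p N i k - N.δ o i ∧ e.p N i k - N.δ o i ≤ b := fun i hi =>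
    ⟨neg_le_neg_iff.1 ((hm i hi).1 k (by simp) le_rfl), (hb i hi).1 k (by simp) le_rfl⟩
  constructor
  · intro i hi j hj
    have e1 : e.x j k - e.x i k - N.δ i j =
        (e.p N j k - N.δ o j) - (e.p N i k - N.δ o i) := by
      simp only [NetworkRun.p, ← hδ o i j]; ring
    rw [e1]
    obtain ⟨h3, h4⟩ := hpos i hi
    obtain ⟨h5, h6⟩ := hpos j hj
    have h7 : |(e.p N j k - N.δ o j) - (e.p N i k - N.δ o i)| ≤ b - m :=
      abs_le.2 ⟨by linarith, by linarith⟩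
    have h8 := mul_nonneg hsum0 hW0
    linarith
  · intro i hi
    obtain ⟨h3, h4⟩ := hpos i hi
    have h5 : e.p N i k - N.δ o i + c i * e.q N i k ≤ b := (hb i hi).2
    have h6 : m ≤ e.p N i k - N.δ o i + c i * e.q N i k := by
      have := (hm i hi).2
      linarith
    have h7 : c i * |e.q N i k| ≤ b - m := by
      have h8 : |c i * e.q N i k| = c i * |e.q N i k| := by rw [abs_mul, abs_of_pos (hc i)]
      rw [← h8]
      exact abs_le.2 ⟨by linarith, by linarith⟩
    have h8 : |e.q N i k| ≤ (c i)⁻¹ * (θ⁻¹ * w * ρ ^ k) := by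
      rw [le_inv_mul_iff₀ (hc i)]
      exact h7.trans hW
    have h9 : (c i)⁻¹ * (θ⁻¹ * w * ρ ^ k) ≤ (∑ j, (c j)⁻¹) * (θ⁻¹ * w * ρ ^ k) := by
      gcongr
      exact hsum i
    change |e.q N i k| ≤ _
    linarith

theorem ExponentialRate.resilientMovement {V : Type*} [Fintype V] {N : VehicleNetwork V}
    (h : ExponentialRate N) : ResilientMovement N := by
  obtain ⟨ρ, hρ0, hρ1, h⟩ := h
  intro M hM e he
  obtain ⟨C, hC⟩ := h M hM e he
  have hlim : Tendsto (fun k : ℕ => C * ρ ^ k) atTop (𝓝 0) := by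
    simpa using (tendsto_pow_atTop_nhds_zero_of_lt_one hρ0.le hρ1).const_mul C
  have key : ∀ (s : ℕ → ℝ) (l : ℝ), (∀ k, |s k - l| ≤ C * ρ ^ k) → Tendsto s atTop (𝓝 l) := by
    intro s l hs
    rw [tendsto_iff_dist_tendsto_zero]
    exact squeeze_zero (fun _ => dist_nonneg) (fun k => by rw [Real.dist_eq]; exact hs k) hlim
  exact ⟨fun i hi j hj => key _ _ fun k => (hC k).1 i hi j hj,
    fun i hi => key _ _ fun k => (hC k).2 i hi⟩

/-! ### Necessity of robustness -/

/-- If all values in `A` vanish and there are at most `f` values outside of `A`, then all retained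
values vanish. -/
theorem IgnoresExtremes.eq_zero {V : Type*} [DecidableEq V] {f : ℕ} {B S A : Finset V} {d : V → ℝ}
    (h : IgnoresExtremes f B d S) (hA : (B \ A).card ≤ f) (hd : ∀ j ∈ A, d j = 0) {j : V}
    (hj : j ∈ B \ S) : d j = 0 := by
  have hmem : ∀ l ∈ B, l ∉ B \ A → d l = 0 := fun l hl hlA => hd l (by
    by_contra hl'
    exact hlA (Finset.mem_sdiff.2 ⟨hl, hl'⟩))
  -- The neighbours outside `A` play the role of the malicious ones, with threshold b = 0.
  have h1 := h.le_bound hA le_rfl (fun l hl hlA => (hmem l hl hlA).le) hj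
  have h2 := h.neg.le_bound hA le_rfl (fun l hl hlA => by rw [hmem l hl hlA, neg_zero]) hj
  linarith

namespace VehicleNetwork

variable {V : Type*} [Fintype V] (N : VehicleNetwork V) (M : Finset V)

/-- The relative positions as seen by `i` without delays in a given state of the network. -/
def relPos (s : V → ℝ × ℝ) (i j : V) : ℝ := (s j).1 - (s i).1 - N.δ i j

/-- A choice of ignored neighbours in a given state. -/
noncomputable def ignoredAt (s : V → ℝ × ℝ) (i : V) : Finset V :=
  (exists_ignoresExtremes N.f (inNeighbors N.G i) (N.relPos s i)).choose

theorem ignoredAt_spec (s : V → ℝ × ℝ) (i : V) :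
    IgnoresExtremes N.f (inNeighbors N.G i) (N.relPos s i) (N.ignoredAt s i) :=
  (exists_ignoresExtremes N.f (inNeighbors N.G i) (N.relPos s i)).choose_spec

open Classical in
/-- The control inputs in a given state, without delays, when the vehicles in `M` do not
accelerate. -/
noncomputable def inputAt (k : ℕ) (s : V → ℝ × ℝ) (i : V) : ℝ :=
  if i ∈ M then 0 else
    (∑ j ∈ inNeighbors N.G i \ N.ignoredAt s i, N.a k i j * N.relPos s i j)
      - N.α i * ((s i).2 - N.r)

/-- The positions and velocities at all times, without delays, from initial positions `x₀`. -/
noncomputable def stateAt (x₀ : V → ℝ) : ℕ → V → ℝ × ℝ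
  | 0 => fun i => (x₀ i, N.r)
  | k + 1 => fun i =>
    ((stateAt x₀ k i).1 + N.T * (stateAt x₀ k i).2 + N.T ^ 2 / 2 * N.inputAt M k (stateAt x₀ k) i,
      (stateAt x₀ k i).2 + N.T * N.inputAt M k (stateAt x₀ k) i)

/-- The run with permanent updates, without delays and with truthful broadcasts, where the vehicles
in `M` do not accelerate. -/
noncomputable def undelayedRun (x₀ : V → ℝ) : NetworkRun V where
  x i k := (N.stateAt M x₀ k.toNat i).1
  v i k := (N.stateAt M x₀ k.toNat i).2
  u i k := N.inputAt M k.toNat (N.stateAt M x₀ k.toNat) i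
  seen _ j k := (N.stateAt M x₀ k.toNat j).1
  upd _ := Set.univ
  delay _ _ _ := 0
  ignored i k := N.ignoredAt (N.stateAt M x₀ k.toNat) i

theorem rel_undelayedRun (x₀ : V → ℝ) (i j : V) (k : ℤ) :
    (N.undelayedRun M x₀).rel N i j k = N.relPos (N.stateAt M x₀ k.toNat) i j := by
  simp only [NetworkRun.rel, NetworkRun.pSeen, NetworkRun.p, undelayedRun, relPos, Nat.cast_zero,
    sub_zero]
  ring

/-- At negative times `Int.toNat` freezes the initial state, and the filtering rule holds there as
well. -/
theorem isRun_undelayedRun (x₀ : V → ℝ) : IsRun N M (N.undelayedRun M x₀) where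
  position i k := rfl
  velocity i k := rfl
  truthful i j k _ := rfl
  delay_le i _ j _ k := Nat.zero_le _
  update i _ k _ := by
    simp only [rel_undelayedRun]
    exact N.ignoredAt_spec _ i
  hold i _ k hk := absurd (Set.mem_univ k) hk
  control i hi k := by
    simp only [rel_undelayedRun]
    exact if_neg hi

variable {N M}

/-- A set of vehicles in formation, whose normal members have at most `f` neighbours outside of
the set, keeps moving with the desired velocity whatever the other vehicles do. -/
theorem stateAt_eq [DecidableEq V] (hδ : ∀ i j l, N.δ i j + N.δ j l = N.δ i l) {x₀ : V → ℝ}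
    {o : V} {κ : ℝ} {A : Finset V} (hA : ∀ i ∈ A, i ∉ M → (inNeighbors N.G i \ A).card ≤ N.f)
    (h₀ : ∀ i ∈ A, x₀ i = N.δ o i + κ) (k : ℕ) :
    ∀ i ∈ A, N.stateAt M x₀ k i = (N.δ o i + κ + k * N.T * N.r, N.r) := by
  induction k with
  | zero =>
    intro i hi
    simp [stateAt, h₀ i hi]
  | succ k ih =>
    intro i hi
    have hu : N.inputAt M k (N.stateAt M x₀ k) i = 0 := by
      by_cases hiM : i ∈ M
      · simp [inputAt, hiM]
      · rw [inputAt, if_neg hiM, ih i hi, sub_self, mul_zero, sub_zero]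
        refine Finset.sum_eq_zero fun j hj => ?_
        rw [(N.ignoredAt_spec (N.stateAt M x₀ k) i).eq_zero (hA i hi hiM) (fun l hl => ?_)
          (by convert hj), mul_zero]
        rw [relPos, ih l hl, ih i hi, ← hδ o i l]
        ring
    simp only [stateAt, hu, ih i hi]
    ext
    · push_cast; ring
    · simp

end VehicleNetwork

/-- Two disjoint groups of vehicles obstruct resilient movement when all but `f` of their members
have at most `f` neighbours outside of their group. -/
theorem ResilientMovement.false_of_groups {V : Type*} [Fintype V] {N : VehicleNetwork V}
    (h : ResilientMovement N) (hδ : ∀ i j l, N.δ i j + N.δ j l = N.δ i l) {A₁ A₂ : Finset V}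
    (hd : Disjoint A₁ A₂) (h₁ : reachable N.G (N.f + 1) A₁ ≠ A₁)
    (h₂ : reachable N.G (N.f + 1) A₂ ≠ A₂)
    (hc : (reachable N.G (N.f + 1) A₁).card + (reachable N.G (N.f + 1) A₂).card ≤ N.f) :
    False := by
  classical
  have hsub : ∀ A, reachable N.G (N.f + 1) A ⊆ A := fun A => Finset.filter_subset _ _
  have hex : ∀ A, reachable N.G (N.f + 1) A ≠ A → ∃ i ∈ A, i ∉ reachable N.G (N.f + 1) A := by
    intro A hA
    by_contra! hall
    exact hA ((hsub A).antisymm hall)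
  have hcard : ∀ A, ∀ i ∈ A, i ∉ reachable N.G (N.f + 1) A →
      (inNeighbors N.G i \ A).card ≤ N.f := by
    intro A i hi hiA
    rw [reachable, Finset.mem_filter, not_and, not_le, Nat.lt_succ_iff] at hiA
    convert hiA hi
  obtain ⟨i, hi, hir⟩ := hex A₁ h₁
  obtain ⟨j, hj, hjr⟩ := hex A₂ h₂
  set M := reachable N.G (N.f + 1) A₁ ∪ reachable N.G (N.f + 1) A₂ with hMdef
  have hiM : i ∉ M := by
    rw [hMdef, Finset.mem_union, not_or]
    exact ⟨hir, fun hi' => Finset.disjoint_left.1 hd hi (hsub _ hi')⟩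
  have hjM : j ∉ M := by
    rw [hMdef, Finset.mem_union, not_or]
    exact ⟨fun hj' => Finset.disjoint_left.1 hd (hsub _ hj') hj, hjr⟩
  have hA₁ : ∀ l ∈ A₁, l ∉ M → (inNeighbors N.G l \ A₁).card ≤ N.f := fun l hl hlM =>
    hcard _ l hl fun hl' => hlM (Finset.mem_union_left _ hl')
  have hA₂ : ∀ l ∈ A₂, l ∉ M → (inNeighbors N.G l \ A₂).card ≤ N.f := fun l hl hlM =>
    hcard _ l hl fun hl' => hlM (Finset.mem_union_right _ hl')
  -- Both groups are in formation, but the second is displaced by 1.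
  set x₀ : V → ℝ := fun l => N.δ i l + if l ∈ A₂ then 1 else 0 with hx₀
  have hs₁ := VehicleNetwork.stateAt_eq hδ hA₁ (x₀ := x₀) (o := i) (κ := 0) (fun l hl => by
    simp [hx₀, Finset.disjoint_left.1 hd hl])
  have hs₂ := VehicleNetwork.stateAt_eq hδ hA₂ (x₀ := x₀) (o := i) (κ := 1) (fun l hl => by
    simp [hx₀, hl])
  have hlim := (h M ((Finset.card_union_le _ _).trans hc) _
    (N.isRun_undelayedRun M x₀)).1 i hiM j hjM
  have hconst : ∀ k : ℕ, (N.undelayedRun M x₀).x j k - (N.undelayedRun M x₀).x i k =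
      N.δ i j + 1 := by
    intro k
    have e₁ : (N.undelayedRun M x₀).x i k = N.δ i i + 0 + k * N.T * N.r := by
      simp only [VehicleNetwork.undelayedRun, Int.toNat_natCast, hs₁ k i hi]
    have e₂ : (N.undelayedRun M x₀).x j k = N.δ i j + 1 + k * N.T * N.r := by
      simp only [VehicleNetwork.undelayedRun, Int.toNat_natCast, hs₂ k j hj]
    have := hδ i i i
    rw [e₁, e₂]
    linarith
  simp only [hconst] at hlim
  linarith [tendsto_nhds_unique hlim tendsto_const_nhds]

theorem ResilientMovement.isRobust {V : Type*} [Fintype V] {N : VehicleNetwork V}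
    (h : ResilientMovement N) (hδ : ∀ i j l, N.δ i j + N.δ j l = N.δ i l)
    (hn : 1 < Fintype.card V) : IsRobust N.G (N.f + 1) (N.f + 1) := by
  classical
  -- The size condition in robustness also has to be derived. If n ≤ f + 1, no vehicle has f + 1
  -- neighbours outside a singleton, so two singletons already obstruct.
  have hlt : N.f + 1 < Fintype.card V := by
    by_contra! hle
    obtain ⟨a, b, hab⟩ := Fintype.exists_pair_of_one_lt_card hn
    have hempty : ∀ c : V, reachable N.G (N.f + 1) {c} = ∅ := by
      intro c
      rw [reachable, Finset.filter_eq_empty_iff]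
      intro i _ hi
      have h1 : (inNeighbors N.G i \ {c}).card < Fintype.card V :=
        Finset.card_lt_univ_of_notMem (x := c) (by simp)
      have h2 : N.f + 1 ≤ (inNeighbors N.G i \ {c}).card := by convert hi
      omega
    refine h.false_of_groups hδ (A₁ := {a}) (A₂ := {b}) (by simpa using hab) ?_ ?_ ?_
    · rw [hempty]; exact (Finset.singleton_ne_empty a).symm
    · rw [hempty]; exact (Finset.singleton_ne_empty b).symm
    · simp [hempty]
  refine ⟨hlt, hlt, fun A₁ A₂ _ _ hd => ?_⟩
  by_contra! hcon
  exact h.false_of_groups hδ hd hcon.1 hcon.2.1 (Nat.lt_succ_iff.1 hcon.2.2)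

theorem theorem1 {V : Type*} [Fintype V] (N : VehicleNetwork V)
    (hn : 1 < Fintype.card V) (hN : WellPosed N) :
    (GainCondition N → IsRobust N.G (2 * N.f + 1) 1 →
      ResilientMovement N ∧ ExponentialRate N) ∧
    (ResilientMovement N → IsRobust N.G (N.f + 1) (N.f + 1)) := by
  refine ⟨fun hgain hrob => ?_, fun h => h.isRobust hN.2.2.1 hn⟩
  have h := exponentialRate_of_isRobust hN hgain hrob
  exact ⟨h.resilientMovement, h⟩
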